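/- Let $n\ge 1$, $p\ge 1$, $s\in\{1,\dots,p\}$ and $\sigma>0$. For $u\in\mathbb R^n$ put $\|u\|_n^2=\frac1n\sum_{i=1}^n u_i^2$; for $\beta\in\mathbb R^p$ put $|\beta|_q=(\sum_{j=1}^p|\beta_j|^q)^{1/q}$ ($0<q<\infty$), and let $|\beta|_0$ be the number of nonzero coordinates of $\beta$. Let $\mathbb X\in\mathbb R^{n\times p}$ satisfy the strong restricted eigenvalue condition $SRE(s,7)$: $\|\mathbb X e_j\|_n\le 1$ for every canonical basis vector $e_j$ of $\mathbb R^p$, and $$\theta(s,7)=\min\Big\{\frac{\|\mathbb X\delta\|_n}{|\delta|_2}:\ \delta\in\mathbb R^p,\ \delta\neq 0,\ |\delta|_1\le 8\sqrt s\,|\delta|_2\Big\}>0 .$$ Let $f\in\mathbb R^n$ be arbitrary, let $y=f+\xi$ with $\xi\sim\mathcal N(0,\sigma^2 I_n)$, let $$\lambda\ \ge\ 2(4+\sqrt2)\,\sigma\sqrt{\frac{\log(2ep/s)}{n}},$$ and let $\hat\beta$ be the Lasso estimator, i.e. any (measurable) solution of $$\hat\beta\in\operatorname*{argmin}_{b\in\mathbb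 R^p}\big(\|\mathbb X b-y\|_n^2+2\lambda|b|_1\big).$$ Then, for every $\beta\in\mathbb R^p$ with $|\beta|_0\le s$, $$\mathbb E\Big[\frac\lambda2|\hat\beta-\beta|_1+\|\mathbb X\hat\beta-f\|_n^2\Big]\le\|\mathbb X\beta-f\|_n^2+\frac{49\lambda^2s}{16}\Big(\frac1{\theta^2(s,7)}+\frac1{2\log(2ep)}\Big).$$ Furthermore, if $f=\mathbb X\beta^*$ for some $\beta^*\in\mathbb R^p$ with $|\beta^*|_0\le s$, then for every $1\le q\le 2$, $$\mathbb E\big[|\beta^*-\hat\beta|_q^q\big]\le\frac{49^q\lambda^q s}{8^q}\Big(\frac1{\theta^{2q}(s,7)}+\frac1{(\log(2ep))^q}\Big).$$ In both cases the expectation is that of an integrable random variable. -/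

import Mathlib

open MeasureTheory ProbabilityTheory
open scoped Matrix

noncomputable section

namespace SparseReg

/-- The empirical norm: `‖u‖_n² = (1/n) ∑ i, u_i²`. -/
def empNorm {n : ℕ} (u : Fin n → ℝ) : ℝ :=
  Real.sqrt ((1 / (n : ℝ)) * ∑ i, u i ^ 2)

/-- The `ℓ_q` norm `|β|_q = (∑ j, |β_j|^q)^(1/q)` for real `0 < q < ∞`. -/
def lqNorm {p : ℕ} (q : ℝ) (β : Fin p → ℝ) : ℝ :=
  (∑ j, |β j| ^ q) ^ (1 / q)

/-- The number of nonzero coordinates, `|β|_0`. -/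
def l0Norm {p : ℕ} (β : Fin p → ℝ) : ℕ :=
  (Finset.univ.filter fun j => β j ≠ 0).card

/-- The cone `{δ : |δ|_1 ≤ (1 + c₀) √s |δ|_2}`. -/
def coneSRE (p s : ℕ) (c₀ : ℝ) : Set (Fin p → ℝ) :=
  {δ | lqNorm 1 δ ≤ (1 + c₀) * Real.sqrt s * lqNorm 2 δ}

/-- The constant `θ(s, c₀)`: the least value of `‖Xδ‖_n / |δ|_2` over the nonzero `δ` in the
cone. -/
def theta {n p : ℕ} (X : Matrix (Fin n) (Fin p) ℝ) (s : ℕ) (c₀ : ℝ) : ℝ :=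
  sInf ((fun δ => empNorm (X *ᵥ δ) / lqNorm 2 δ) '' {δ | δ ∈ coneSRE p s c₀ ∧ δ ≠ 0})

/-- The Strong Restricted Eigenvalue condition `SRE(s, c₀)`. -/
def SRE {n p : ℕ} (X : Matrix (Fin n) (Fin p) ℝ) (s : ℕ) (c₀ : ℝ) : Prop :=
  (∀ j, empNorm (X *ᵥ Pi.single j 1) ≤ 1) ∧ 0 < theta X s c₀

/-- `b` is a solution of the Lasso problem with data `y` and tuning parameter `lam`. -/
def IsLasso {n p : ℕ} (X : Matrix (Fin n) (Fin p) ℝ) (y : Fin n → ℝ) (lam : ℝ)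
    (b : Fin p → ℝ) : Prop :=
  ∀ β : Fin p → ℝ,
    empNorm (X *ᵥ b - y) ^ 2 + 2 * lam * lqNorm 1 b ≤
      empNorm (X *ᵥ β - y) ^ 2 + 2 * lam * lqNorm 1 β

/-- The Gaussian law `N(0, σ² I_n)`: independent coordinates, each `N(0, σ²)`. -/
def isotropicGaussian (n : ℕ) (σ : ℝ) : Measure (Fin n → ℝ) :=
  Measure.pi fun _ => gaussianReal 0 (Real.toNNReal (σ ^ 2))

end SparseReg

end

/-!
The bounds follow from a deterministic analysis of the Lasso on two regimes of the noise. Write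
`u = βhat - β`, `L = log (2ep/s)` and `g_j = ⟨X e_j, ξ⟩ / (σ √n)`, Gaussian variables of variance at
most `1`, and let `S` be the set of the `s` largest coordinates of `u`. The optimality condition
(`IsLasso.basic_inequality`) bounds the excess risk by twice the noise `⟨ξ, Xu⟩ / n`, plus `2λ`
times `5/4 √s |u|₂ - 3/4 ∑_{j ∉ S} |u_j|`, minus `‖Xu‖_n²`.

* If any `s` of the `g_j²` have average at most `16 L`, the rearrangement inequality
  (`exists_top_set`) bounds the noise by `3/8 λ (√s |u|₂ + ∑_{j ∉ S} |u_j|)`. Either the resulting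
  linear term is negative, or `u` lies in the cone and `√s |u|₂ ≤ √s ‖Xu‖_n / θ` can be absorbed by
  the quadratic term.
* Otherwise the noise is at most `R ‖Xu‖_n`, where `n R²` is the squared length of the projection
  of `ξ` on the column space of `X`. That space has dimension at most `p`, possibly much larger than
  `s`, but this regime is so rare that `R²` restricted to it has second moment far below `λ⁴ s²`:
  the exponential moment `E exp (3 g² / 8) ≤ 2` bounds the probability by a high power of `s / p`
  (`exists_noise_majorant`).

The constant obtained in the first regime is `169/64`, less than `49/16`, and `θ ≤ 1` because the
basis vectors lie in the cone; the difference pays for the second regime. No concentration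
inequality for suprema of Gaussian processes is needed, and the nonnegative logarithmic terms on the
right-hand sides are only added at the end.
-/

namespace SparseReg

/-! ### Exponential moments of squared Gaussian linear forms -/

/-- Proved by factorizing the characteristic function. -/
lemma map_sum_mul_isotropicGaussian {n : ℕ} (σ : ℝ) (v : Fin n → ℝ) :
    (isotropicGaussian n σ).map (fun x => ∑ i, v i * x i) =
      gaussianReal 0 (Real.toNNReal (σ ^ 2 * ∑ i, v i ^ 2)) := by
  have : IsProbabilityMeasure (isotropicGaussian n σ) := by
    unfold isotropicGaussian; infer_instance
  have hm : Measurable (fun x : Fin n → ℝ => ∑ i, v i * x i) := by fun_prop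
  have := Measure.isProbabilityMeasure_map (μ := isotropicGaussian n σ) hm.aemeasurable
  apply Measure.ext_of_charFun
  ext t
  rw [charFun_apply_real, integral_map hm.aemeasurable (by fun_prop), charFun_gaussianReal]
  have h1 : ∀ x : Fin n → ℝ, Complex.exp (t * ((∑ i, v i * x i : ℝ) : ℂ) * Complex.I) =
      ∏ i, Complex.exp (((t * v i : ℝ) : ℂ) * (x i : ℂ) * Complex.I) := by
    intro x
    rw [← Complex.exp_sum]
    congr 1
    push_cast
    rw [Finset.mul_sum, Finset.sum_mul]
    exact Finset.sum_congr rfl fun i _ => by ring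
  simp_rw [h1]
  rw [isotropicGaussian, integral_fintype_prod_eq_prod
    (f := fun i (y : ℝ) => Complex.exp (((t * v i : ℝ) : ℂ) * (y : ℂ) * Complex.I))]
  simp_rw [← charFun_apply_real, charFun_gaussianReal]
  rw [← Complex.exp_sum]
  congr 1
  have hn : 0 ≤ σ ^ 2 * ∑ i, v i ^ 2 :=
    mul_nonneg (sq_nonneg _) (Finset.sum_nonneg fun i _ => sq_nonneg _)
  have hcast : ∀ a : ℝ, 0 ≤ a → (((a.toNNReal : NNReal) : ℝ) : ℂ) = (a : ℂ) := fun a ha => by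
    rw [Real.coe_toNNReal _ ha]
  rw [hcast _ hn, hcast _ (sq_nonneg σ)]
  push_cast
  simp only [mul_zero, zero_mul, zero_sub, Finset.mul_sum, Finset.sum_mul, Finset.sum_div,
    ← Finset.sum_neg_distrib]
  exact Finset.sum_congr rfl fun i _ => by ring

lemma exp_sq_gaussianReal :
    Integrable (fun x : ℝ => Real.exp (3 / 8 * x ^ 2)) (gaussianReal 0 1) ∧
      ∫ x, Real.exp (3 / 8 * x ^ 2) ∂gaussianReal 0 1 = 2 := by
  have key : ∀ x : ℝ, gaussianPDFReal 0 1 x * Real.exp (3 / 8 * x ^ 2) =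
      (Real.sqrt (2 * Real.pi))⁻¹ * Real.exp (-(1 / 8) * x ^ 2) := by
    intro x
    rw [gaussianPDFReal]
    simp only [NNReal.coe_one, mul_one, sub_zero]
    rw [mul_assoc, ← Real.exp_add]
    congr 2
    ring
  constructor
  · rw [gaussianReal_of_var_ne_zero _ one_ne_zero, gaussianPDF_def,
      integrable_withDensity_iff_integrable_smul₀' (by fun_prop) (by simp)]
    simp only [smul_eq_mul, ENNReal.toReal_ofReal (gaussianPDFReal_nonneg _ _ _), key]
    exact (integrable_exp_neg_mul_sq (by norm_num)).const_mul _
  · rw [integral_gaussianReal_eq_integral_smul one_ne_zero]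
    simp only [smul_eq_mul, key]
    rw [integral_const_mul, integral_gaussian,
      show Real.pi / (1 / 8) = 2 ^ 2 * (2 * Real.pi) by ring,
      Real.sqrt_mul (by norm_num : (0 : ℝ) ≤ 2 ^ 2), Real.sqrt_sq (by norm_num : (0 : ℝ) ≤ 2)]
    have : Real.sqrt (2 * Real.pi) ≠ 0 := by positivity
    field_simp

/-- The linear form `⟨v, ξ⟩ / σ` is distributed as `|v|₂ Z` with `Z` standard normal, so that
`|v|₂ ≤ 1` bounds its squared exponential moment by that of `Z`. -/
lemma exp_sq_linearForm {Ω : Type*} [MeasurableSpace Ω] {P : Measure Ω} {n : ℕ} {σ : ℝ}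
    (hσ : 0 < σ) {ξ : Ω → Fin n → ℝ} (hξ : HasLaw ξ (isotropicGaussian n σ) P)
    (v : Fin n → ℝ) (hv : ∑ i, v i ^ 2 ≤ 1) :
    Integrable (fun ω => Real.exp (3 / 8 * ((∑ i, v i * ξ ω i) / σ) ^ 2)) P ∧
      ∫ ω, Real.exp (3 / 8 * ((∑ i, v i * ξ ω i) / σ) ^ 2) ∂P ≤ 2 := by
  obtain ⟨hi, he⟩ := exp_sq_gaussianReal
  set c : ℝ := σ * Real.sqrt (∑ i, v i ^ 2) with hc
  have h0 : 0 ≤ ∑ i, v i ^ 2 := Finset.sum_nonneg fun i _ => sq_nonneg _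
  have hlaw : HasLaw (fun ω => ∑ i, v i * ξ ω i) ((gaussianReal 0 1).map (c * ·)) P := by
    have h1 : HasLaw (fun x : Fin n → ℝ => ∑ i, v i * x i)
        ((gaussianReal 0 1).map (c * ·)) (isotropicGaussian n σ) := by
      refine ⟨Measurable.aemeasurable (by fun_prop), ?_⟩
      rw [map_sum_mul_isotropicGaussian, gaussianReal_map_const_mul]
      congr 1
      · simp
      · ext
        simp [hc, mul_pow, Real.sq_sqrt h0]
        positivity
    exact h1.fun_comp hξ
  have hle : ∀ x : ℝ, Real.exp (3 / 8 * (c * x / σ) ^ 2) ≤ Real.exp (3 / 8 * x ^ 2) := by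
    intro x
    apply Real.exp_le_exp.2
    rw [hc, show σ * Real.sqrt (∑ i, v i ^ 2) * x / σ = Real.sqrt (∑ i, v i ^ 2) * x by
      field_simp, mul_pow, Real.sq_sqrt h0]
    nlinarith [sq_nonneg x]
  have hm : AEStronglyMeasurable (fun y : ℝ => Real.exp (3 / 8 * (y / σ) ^ 2))
      ((gaussianReal 0 1).map (c * ·)) := by fun_prop
  have hi' : Integrable (fun x : ℝ => Real.exp (3 / 8 * (c * x / σ) ^ 2)) (gaussianReal 0 1) :=
    hi.mono' (by fun_prop) (.of_forall fun x => by
      rw [Real.norm_eq_abs, abs_of_pos (Real.exp_pos _)]; exact hle x)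
  constructor
  · have : Integrable (fun y : ℝ => Real.exp (3 / 8 * (y / σ) ^ 2))
        (P.map fun ω => ∑ i, v i * ξ ω i) := by
      rw [hlaw.map_eq]
      exact (integrable_map_measure hm (by fun_prop)).2 hi'
    exact this.comp_aemeasurable hlaw.aemeasurable
  · have h2 := hlaw.integral_comp hm
    rw [integral_map (by fun_prop) hm] at h2
    calc _ = ∫ x, Real.exp (3 / 8 * (c * x / σ) ^ 2) ∂gaussianReal 0 1 := h2
      _ ≤ _ := integral_mono hi' hi hle
      _ = 2 := he

/-! ### Norms -/

lemma lqNorm_one {p : ℕ} (β : Fin p → ℝ) : lqNorm 1 β = ∑ j, |β j| := by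
  simp [lqNorm]

lemma lqNorm_two {p : ℕ} (β : Fin p → ℝ) : lqNorm 2 β = Real.sqrt (∑ j, β j ^ 2) := by
  simp [lqNorm, Real.sqrt_eq_rpow]

lemma lqNorm_nonneg {p : ℕ} (q : ℝ) (β : Fin p → ℝ) : 0 ≤ lqNorm q β :=
  Real.rpow_nonneg (Finset.sum_nonneg fun _ _ => Real.rpow_nonneg (abs_nonneg _) _) _

lemma lqNorm_rpow {p : ℕ} {q : ℝ} (hq : 1 ≤ q) (β : Fin p → ℝ) :
    lqNorm q β ^ q = ∑ j, |β j| ^ q := by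
  rw [lqNorm, ← Real.rpow_mul (Finset.sum_nonneg fun _ _ => Real.rpow_nonneg (abs_nonneg _) _),
    one_div, inv_mul_cancel₀ (by linarith), Real.rpow_one]

lemma lqNorm_two_pos {p : ℕ} {β : Fin p → ℝ} (hβ : β ≠ 0) : 0 < lqNorm 2 β := by
  rw [lqNorm_two, Real.sqrt_pos]
  obtain ⟨j, hj⟩ := Function.ne_iff.1 hβ
  exact Finset.sum_pos' (fun i _ => sq_nonneg _) ⟨j, Finset.mem_univ _, sq_pos_of_ne_zero hj⟩

lemma empNorm_nonneg {n : ℕ} (u : Fin n → ℝ) : 0 ≤ empNorm u := Real.sqrt_nonneg _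

lemma empNorm_sq {n : ℕ} (u : Fin n → ℝ) : empNorm u ^ 2 = (1 / (n : ℝ)) * ∑ i, u i ^ 2 :=
  Real.sq_sqrt (mul_nonneg (by positivity) (Finset.sum_nonneg fun i _ => sq_nonneg _))

/-- Hölder's inequality between the exponents `1` and `2`, in the form needed to interpolate a pair
of bounds `∑ a ≤ m` and `∑ a² ≤ M`. -/
lemma sum_rpow_le_interpolation {ι : Type*} (t : Finset ι) (a : ι → ℝ) (ha : ∀ i, 0 ≤ a i)
    {q : ℝ} (hq1 : 1 ≤ q) (hq2 : q ≤ 2) {m M : ℝ} (hm : ∑ i ∈ t, a i ≤ m)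
    (hM : ∑ i ∈ t, a i ^ 2 ≤ M) :
    ∑ i ∈ t, a i ^ q ≤ m ^ (2 - q) * M ^ (q - 1) := by
  have hs1 : 0 ≤ ∑ i ∈ t, a i := Finset.sum_nonneg fun i _ => ha i
  have hs2 : 0 ≤ ∑ i ∈ t, a i ^ 2 := Finset.sum_nonneg fun i _ => sq_nonneg _
  have key : ∑ i ∈ t, a i ^ q ≤ (∑ i ∈ t, a i) ^ (2 - q) * (∑ i ∈ t, a i ^ 2) ^ (q - 1) := by
    rcases eq_or_lt_of_le hq1 with rfl | hq1
    · norm_num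
    rcases eq_or_lt_of_le hq2 with rfl | hq2
    · norm_num
    have hpq : Real.HolderConjugate (1 / (2 - q)) (1 / (q - 1)) := by
      rw [Real.holderConjugate_iff]
      refine ⟨?_, by simp only [one_div, inv_inv]; ring⟩
      rw [lt_div_iff₀ (by linarith)]; linarith
    have h := Real.inner_le_Lp_mul_Lq_of_nonneg t hpq
      (f := fun i => a i ^ (2 - q)) (g := fun i => (a i ^ 2) ^ (q - 1))
      (fun i _ => Real.rpow_nonneg (ha i) _) (fun i _ => Real.rpow_nonneg (sq_nonneg _) _)
    have e1 : ∀ i, (a i ^ (2 - q)) ^ (1 / (2 - q)) = a i := fun i => by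
      rw [← Real.rpow_mul (ha i), mul_one_div_cancel (by linarith), Real.rpow_one]
    have e2 : ∀ i, ((a i ^ 2) ^ (q - 1)) ^ (1 / (q - 1)) = a i ^ 2 := fun i => by
      rw [← Real.rpow_mul (sq_nonneg _), mul_one_div_cancel (by linarith), Real.rpow_one]
    have e3 : ∀ i, a i ^ (2 - q) * (a i ^ 2) ^ (q - 1) = a i ^ q := fun i => by
      rw [← Real.rpow_natCast, ← Real.rpow_mul (ha i), ← Real.rpow_add_of_nonneg (ha i)
        (by linarith) (by push_cast; linarith)]
      congr 1; push_cast; ring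
    simp only [e1, e2, e3, one_div_one_div] at h
    exact h
  exact key.trans (mul_le_mul (Real.rpow_le_rpow hs1 hm (by linarith))
    (Real.rpow_le_rpow hs2 hM (by linarith)) (Real.rpow_nonneg hs2 _)
    (Real.rpow_nonneg (hs1.trans hm) _))

/-! ### Geometry of the design -/

/-- Cauchy–Schwarz restricted to the column space: an orthonormal basis of the range of `X` has at
most `p` elements, and only the projection of `z` onto that range sees `X u`. -/
lemma exists_orthonormal_range {n p : ℕ} (X : Matrix (Fin n) (Fin p) ℝ) :
    ∃ r ≤ p, ∃ v : Fin r → Fin n → ℝ, (∀ k, ∑ i, v k i ^ 2 ≤ 1) ∧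
      ∀ (z : Fin n → ℝ) (u : Fin p → ℝ), (∑ i, z i * (X *ᵥ u) i) ^ 2 ≤
        (∑ k, (∑ i, v k i * z i) ^ 2) * ∑ i, (X *ᵥ u) i ^ 2 := by
  let T : (Fin p → ℝ) →ₗ[ℝ] EuclideanSpace ℝ (Fin n) :=
    (WithLp.linearEquiv 2 ℝ (Fin n → ℝ)).symm.toLinearMap ∘ₗ X.mulVecLin
  let W := LinearMap.range T
  let b := stdOrthonormalBasis ℝ W
  have hT : ∀ u i, (T u) i = (X *ᵥ u) i := fun u i => rfl
  refine ⟨Module.finrank ℝ W, ?_, fun k i => (b k : EuclideanSpace ℝ (Fin n)) i, ?_, ?_⟩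
  · simpa using LinearMap.finrank_range_le T
  · intro k
    have h := b.orthonormal.1 k
    rw [← EuclideanSpace.real_norm_sq_eq, Submodule.norm_coe, h]; norm_num
  · intro z u
    set y : W := ⟨T u, LinearMap.mem_range_self T u⟩ with hy
    have hinner : ∀ a c : EuclideanSpace ℝ (Fin n), inner ℝ a c = ∑ i, a i * c i := fun a c => by
      simp [PiLp.inner_apply, mul_comm]
    have hexp : ∀ i, (X *ᵥ u) i = ∑ k, inner ℝ (b k) y * (b k : EuclideanSpace ℝ (Fin n)) i := by
      intro i
      have := congrArg (fun w : W => (w : EuclideanSpace ℝ (Fin n)) i) (b.sum_repr' y)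
      simp only [Submodule.coe_sum, Submodule.coe_smul] at this
      rw [← hT, show T u = (y : EuclideanSpace ℝ (Fin n)) from rfl, ← this]
      simp
    have h1 : ∑ i, z i * (X *ᵥ u) i =
        ∑ k, (∑ i, (b k : EuclideanSpace ℝ (Fin n)) i * z i) * inner ℝ (b k) y := by
      simp_rw [hexp, Finset.mul_sum, Finset.sum_mul]
      rw [Finset.sum_comm]
      exact Finset.sum_congr rfl fun k _ => Finset.sum_congr rfl fun i _ => by ring
    have h2 : ∑ k, (inner ℝ (b k) y) ^ 2 = ∑ i, (X *ᵥ u) i ^ 2 := by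
      have := b.sum_sq_norm_inner_right y
      simp only [Real.norm_eq_abs, sq_abs] at this
      rw [this, ← Submodule.norm_coe, EuclideanSpace.real_norm_sq_eq]
      rfl
    rw [h1, ← h2]
    exact Finset.sum_mul_sq_le_sq_mul_sq _ _ _

/-! ### Sums over the largest coordinates -/

/-- For each `u` there is a set `S` of `s` indices (those of the largest `|u_j|`) such that

* replacing any set of at most `s` indices by `S` increases the sum of `|u_j|` over it;
* the pairing of `u` with a vector `g` whose squares have averages at most `κ²` over all sets of `s`
  indices is at most `κ` times `√s |u|₂ + ∑_{j ∉ S} |u_j|`.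

The second point is the rearrangement inequality, followed by Cauchy–Schwarz on the `s` largest
entries. -/
lemma exists_top_set {p s : ℕ} (hs1 : 1 ≤ s) (hsp : s ≤ p) (u : Fin p → ℝ) :
    ∃ S : Finset (Fin p), S.card = s ∧
      (∀ J : Finset (Fin p), J.card ≤ s → ∑ j ∈ J, |u j| ≤ ∑ j ∈ S, |u j|) ∧
      ∀ (g : Fin p → ℝ) (κ : ℝ), 0 ≤ κ →
        (∀ T : Finset (Fin p), T.card = s → ∑ j ∈ T, g j ^ 2 ≤ κ ^ 2 * s) →
        ∑ j, u j * g j ≤ κ * (Real.sqrt s * Real.sqrt (∑ j, u j ^ 2) + ∑ j ∈ Sᶜ, |u j|) := by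
  set τ := Tuple.sort (fun j => |u j|) with hτ
  have hmono : Monotone ((fun j => |u j|) ∘ τ) := Tuple.monotone_sort _
  set top : Finset (Fin p) := Finset.univ.filter fun i : Fin p => p - s ≤ (i : ℕ) with htop
  have hcard : top.card = s := by
    have h := Fin.card_filter_val_lt (n := p) (m := p - s)
    have h2 := Finset.card_filter_add_card_filter_not (s := (Finset.univ : Finset (Fin p)))
      (fun i : Fin p => (i : ℕ) < p - s)
    simp only [not_lt, Finset.card_univ, Fintype.card_fin] at h2
    rw [htop]
    omega
  have hmaps : ∀ π : Equiv.Perm (Fin p), (top.map π.toEmbedding).card = s := fun π => by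
    rw [Finset.card_map, hcard]
  refine ⟨top.map τ.toEmbedding, hmaps τ, ?_, ?_⟩
  · intro J hJ
    have hne : (top.map τ.toEmbedding).Nonempty := by
      rw [← Finset.card_pos, hmaps]; omega
    set S := top.map τ.toEmbedding with hS
    -- every entry outside `S` is at most every entry inside
    have hle : ∀ i ∉ S, ∀ j ∈ S, |u i| ≤ |u j| := by
      intro i hi j hj
      rw [hS, Finset.mem_map_equiv] at hi hj
      simp only [htop, Finset.mem_filter, Finset.mem_univ, true_and, not_le] at hi hj
      have := hmono (a := τ.symm i) (b := τ.symm j) (by rw [Fin.le_def]; omega)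
      simpa using this
    obtain ⟨j₀, hj₀, hmin⟩ := S.exists_min_image (fun j => |u j|) hne
    have h1 : ∑ j ∈ J \ S, |u j| ≤ (J \ S).card * |u j₀| := by
      rw [← nsmul_eq_mul]
      exact Finset.sum_le_card_nsmul _ _ _ fun i hi => hle i (Finset.mem_sdiff.1 hi).2 _ hj₀
    have h2 : ((S \ J).card : ℝ) * |u j₀| ≤ ∑ j ∈ S \ J, |u j| := by
      rw [← nsmul_eq_mul]
      exact Finset.card_nsmul_le_sum _ _ _ fun i hi => hmin i (Finset.mem_sdiff.1 hi).1
    have h3 : (J \ S).card ≤ (S \ J).card := by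
      have a := Finset.card_sdiff_add_card_inter J S
      have b := Finset.card_sdiff_add_card_inter S J
      rw [Finset.inter_comm] at b
      have : S.card = s := hmaps τ
      omega
    have h4 : ((J \ S).card : ℝ) * |u j₀| ≤ (S \ J).card * |u j₀| := by gcongr
    have a := Finset.sum_inter_add_sum_sdiff J S fun j => |u j|
    have b := Finset.sum_inter_add_sum_sdiff S J fun j => |u j|
    rw [Finset.inter_comm] at b
    linarith
  · intro g κ hκ hg
    set ρ := Tuple.sort (fun j => |g j|) with hρ
    have hmono' : Monotone ((fun j => |g j|) ∘ ρ) := Tuple.monotone_sort _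
    have h1 : ∑ j, u j * g j ≤ ∑ i, |u (τ i)| * |g (ρ i)| := by
      calc ∑ j, u j * g j ≤ ∑ j, |u j| * |g j| :=
            Finset.sum_le_sum fun j _ => by rw [← abs_mul]; exact le_abs_self _
        _ = ∑ i, |u (τ i)| * |g (τ i)| := (Equiv.sum_comp τ fun j => |u j| * |g j|).symm
        _ ≤ _ := by
          have := Monovary.sum_mul_comp_perm_le_sum_mul (hmono.monovary hmono')
            (σ := τ.trans ρ.symm)
          simpa using this
    have h2 : ∑ i ∈ top, |u (τ i)| * |g (ρ i)| ≤
        κ * (Real.sqrt s * Real.sqrt (∑ j, u j ^ 2)) := by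
      have hu : ∑ i ∈ top, |u (τ i)| ^ 2 ≤ ∑ j, u j ^ 2 := by
        calc ∑ i ∈ top, |u (τ i)| ^ 2 ≤ ∑ i, |u (τ i)| ^ 2 :=
              Finset.sum_le_sum_of_subset_of_nonneg (Finset.subset_univ _) fun _ _ _ => by
                positivity
          _ = _ := by simpa using Equiv.sum_comp τ fun j => u j ^ 2
      have hgs : ∑ i ∈ top, |g (ρ i)| ^ 2 ≤ κ ^ 2 * s := by
        simpa using hg _ (hmaps ρ)
      calc ∑ i ∈ top, |u (τ i)| * |g (ρ i)|
          ≤ Real.sqrt (∑ i ∈ top, |u (τ i)| ^ 2) * Real.sqrt (∑ i ∈ top, |g (ρ i)| ^ 2) :=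
            Real.sum_mul_le_sqrt_mul_sqrt _ _ _
        _ ≤ Real.sqrt (∑ j, u j ^ 2) * Real.sqrt (κ ^ 2 * s) := by gcongr
        _ = _ := by rw [Real.sqrt_mul (sq_nonneg κ), Real.sqrt_sq hκ]; ring
    have hκg : ∀ i ∉ top, |g (ρ i)| ≤ κ := by
      intro i hi
      have hall : ∀ j ∈ top, g (ρ i) ^ 2 ≤ g (ρ j) ^ 2 := fun j hj => by
        simp only [htop, Finset.mem_filter, Finset.mem_univ, true_and, not_le] at hi hj
        exact sq_le_sq.2 (hmono' (by rw [Fin.le_def]; omega))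
      have h := Finset.card_nsmul_le_sum top (fun j => g (ρ j) ^ 2) _ hall
      have hgs : ∑ i ∈ top, g (ρ i) ^ 2 ≤ κ ^ 2 * s := by
        simpa using hg _ (hmaps ρ)
      rw [hcard, nsmul_eq_mul] at h
      have hs : (0 : ℝ) < s := by exact_mod_cast hs1
      exact abs_le_of_sq_le_sq (by nlinarith) hκ
    have h3 : ∑ i ∈ topᶜ, |u (τ i)| * |g (ρ i)| ≤
        κ * ∑ j ∈ (top.map τ.toEmbedding)ᶜ, |u j| := by
      have e : ∑ j ∈ (top.map τ.toEmbedding)ᶜ, |u j| = ∑ i ∈ topᶜ, |u (τ i)| := by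
        have a := Finset.sum_add_sum_compl (top.map τ.toEmbedding) fun j => |u j|
        have b := Finset.sum_add_sum_compl top fun i => |u (τ i)|
        have c := Equiv.sum_comp τ fun j => |u j|
        rw [Finset.sum_map] at a
        simp only [Equiv.coe_toEmbedding] at a
        linarith
      rw [e, Finset.mul_sum]
      refine Finset.sum_le_sum fun i hi => ?_
      rw [mul_comm]
      exact mul_le_mul_of_nonneg_right (hκg i (Finset.mem_compl.1 hi)) (abs_nonneg _)
    have h4 := Finset.sum_add_sum_compl top fun i => |u (τ i)| * |g (ρ i)|
    rw [mul_add]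
    linarith

/-! ### The restricted eigenvalue constant -/

lemma theta_mul_le {n p s : ℕ} {c₀ : ℝ} (X : Matrix (Fin n) (Fin p) ℝ) {δ : Fin p → ℝ}
    (hδ : δ ∈ coneSRE p s c₀) : theta X s c₀ * lqNorm 2 δ ≤ empNorm (X *ᵥ δ) := by
  rcases eq_or_ne δ 0 with rfl | h0
  · simpa [lqNorm_two] using empNorm_nonneg _
  · rw [← le_div_iff₀ (lqNorm_two_pos h0)]
    refine csInf_le ⟨0, ?_⟩ ⟨δ, ⟨hδ, h0⟩, rfl⟩
    rintro _ ⟨δ', -, rfl⟩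
    exact div_nonneg (empNorm_nonneg _) (lqNorm_nonneg _ _)

lemma theta_le_empNorm_single {n p s : ℕ} (hs : 1 ≤ s) (X : Matrix (Fin n) (Fin p) ℝ)
    (j : Fin p) : theta X s 7 ≤ empNorm (X *ᵥ Pi.single j 1) := by
  have h2 : lqNorm 2 (Pi.single j 1 : Fin p → ℝ) = 1 := by
    rw [lqNorm_two, Finset.sum_eq_single j (by intro b _ hb; simp [hb]) (by simp)]
    simp
  have h1 : lqNorm 1 (Pi.single j 1 : Fin p → ℝ) = 1 := by
    rw [lqNorm_one, Finset.sum_eq_single j (by intro b _ hb; simp [hb]) (by simp)]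
    simp
  have hs' : (1 : ℝ) ≤ Real.sqrt s := Real.one_le_sqrt.2 (by exact_mod_cast hs)
  have := theta_mul_le (s := s) (c₀ := 7) X (δ := Pi.single j 1) (by
    rw [coneSRE, Set.mem_ofPred_eq, h1, h2]; linarith)
  rwa [h2, mul_one] at this

/-! ### The noise outside the bulk event -/

/-- Chernoff's bound for the event that some `s` of the squares `g_j²` have average above `16 L`,
with the indicator bounded pointwise by a sum of exponentials. -/
lemma one_le_exp_sum_of_large {p s : ℕ} (hs1 : 1 ≤ s) {L : ℝ} {g : Fin p → ℝ}
    {T : Finset (Fin p)} (hT : T.card = s) (hTg : 16 * L * s < ∑ j ∈ T, g j ^ 2) :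
    1 ≤ 1 / (s : ℝ) * Real.exp (-L) ^ 6 * ∑ j, Real.exp (3 / 8 * g j ^ 2) := by
  have hs : (0 : ℝ) < s := by exact_mod_cast hs1
  have h1 : ∀ j, 1 + 3 / 8 * g j ^ 2 - 6 * L ≤
      Real.exp (-L) ^ 6 * Real.exp (3 / 8 * g j ^ 2) := fun j => by
    rw [← Real.exp_nat_mul, ← Real.exp_add]
    have := Real.add_one_le_exp ((6 : ℕ) * -L + 3 / 8 * g j ^ 2)
    push_cast at this ⊢
    linarith
  have h2 : ∑ j ∈ T, (1 + 3 / 8 * g j ^ 2 - 6 * L) ≤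
      ∑ j, Real.exp (-L) ^ 6 * Real.exp (3 / 8 * g j ^ 2) :=
    (Finset.sum_le_sum fun j _ => h1 j).trans
      (Finset.sum_le_sum_of_subset_of_nonneg (Finset.subset_univ _) fun j _ _ => by positivity)
  rw [Finset.sum_sub_distrib, Finset.sum_add_distrib, ← Finset.mul_sum] at h2
  simp only [Finset.sum_const, hT, nsmul_eq_mul, mul_one] at h2
  rw [mul_assoc, one_div, ← div_eq_inv_mul, le_div_iff₀ hs, Finset.mul_sum]
  linarith

/-- With `c = 16 L / 3`, values `x ≤ c` are paid for by `B`, and beyond `c` the function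
`x² exp (-3x/8)` is decreasing. -/
lemma sq_le_exp_of_one_le {L B x : ℝ} (hL1 : 1 ≤ L) (hB : 1 ≤ B) (hx0 : 0 ≤ x) :
    x ^ 2 ≤ (16 / 3 * L) ^ 2 * (B + Real.exp (-L) ^ 2 * Real.exp (3 / 8 * x)) := by
  set c : ℝ := 16 / 3 * L with hc
  have hc0 : 0 < c := by positivity
  have he : 0 < Real.exp (-L) ^ 2 * Real.exp (3 / 8 * x) := by positivity
  rcases le_total x c with hxc | hxc
  · calc x ^ 2 ≤ c ^ 2 * 1 := by rw [mul_one]; gcongr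
      _ ≤ _ := by gcongr; linarith
  · have h1 : x / c ≤ Real.exp (x / c - 1) := by
      have := Real.add_one_le_exp (x / c - 1); linarith
    have h2 : (x / c) ^ 2 ≤ Real.exp (-L) ^ 2 * Real.exp (3 / 8 * x) := by
      calc (x / c) ^ 2 ≤ Real.exp (x / c - 1) ^ 2 := by gcongr
        _ = Real.exp (2 * (x / c - 1)) := by rw [← Real.exp_nat_mul]; norm_num
        _ ≤ Real.exp ((2 : ℕ) * -L + 3 / 8 * x) := by
          apply Real.exp_le_exp.2
          have hy : 1 ≤ x / c := by rwa [one_le_div hc0]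
          have hxy : 3 / 8 * x = 2 * L * (x / c) := by rw [hc]; field_simp; ring
          rw [hxy]
          push_cast
          nlinarith
        _ = _ := by rw [Real.exp_add, Real.exp_nat_mul]
    calc x ^ 2 = c ^ 2 * (x / c) ^ 2 := by field_simp
      _ ≤ _ := by gcongr; linarith

/-- The noise is split according to whether the `s` largest squared correlations
`g_j = ⟨X e_j, ξ⟩ / (σ √n)` have average at most `16 log (2ep/s)`. If not, only the norm of the
projection of `ξ` onto the column space is used; this second regime is so rare that the
corresponding squared norm, in units of `λ² s`, is dominated by a variable `Y` of tiny second
moment. Here `Y²` is an explicit sum of exponentials of squared Gaussian linear forms. -/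
lemma exists_noise_majorant {Ω : Type*} [MeasurableSpace Ω] {P : Measure Ω}
    [IsProbabilityMeasure P] {n p s : ℕ} (hn : 0 < n) (hs1 : 1 ≤ s) (hsp : s ≤ p)
    {σ : ℝ} (hσ : 0 < σ) (X : Matrix (Fin n) (Fin p) ℝ)
    (hcol : ∀ j, ∑ i, X i j ^ 2 ≤ n) {lam L : ℝ} (hlam0 : 0 < lam)
    (hL : L = Real.log (2 * Real.exp 1 * (p : ℝ) / (s : ℝ)))
    (hlam : 100 * σ ^ 2 * L / n ≤ lam ^ 2)
    {ξ : Ω → Fin n → ℝ} (hξ : HasLaw ξ (isotropicGaussian n σ) P) :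
    ∃ Y : Ω → ℝ, (∀ ω, 0 ≤ Y ω) ∧ Integrable Y P ∧ Integrable (fun ω => Y ω ^ 2) P ∧
      ∫ ω, Y ω ∂P ≤ 1 / 10 ∧ ∫ ω, Y ω ^ 2 ∂P ≤ 1 / 100 ∧
      ∀ ω,
        (∀ T : Finset (Fin p), T.card = s →
          ∑ j ∈ T, ((∑ i, X i j / Real.sqrt n * ξ ω i) / σ) ^ 2 ≤ 16 * L * s) ∨
        ∀ u : Fin p → ℝ, 1 / (n : ℝ) * ∑ i, ξ ω i * (X *ᵥ u) i ≤
          lam * Real.sqrt s * Real.sqrt (Y ω) * empNorm (X *ᵥ u) := by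
  obtain ⟨r, hr, v, hv, hproj⟩ := exists_orthonormal_range X
  have hn' : (0 : ℝ) < n := by exact_mod_cast hn
  have hs : (0 : ℝ) < s := by exact_mod_cast hs1
  have hp : (0 : ℝ) < p := by exact_mod_cast hs1.trans hsp
  have hsp' : (s : ℝ) ≤ p := by exact_mod_cast hsp
  have he1 : (1 : ℝ) ≤ Real.exp 1 := Real.one_le_exp (by norm_num)
  have hL1 : 1 ≤ L := by
    rw [hL, Real.le_log_iff_exp_le (by positivity), le_div_iff₀ hs]
    nlinarith [Real.exp_pos 1]
  set ε : ℝ := Real.exp (-L) with hε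
  have hε0 : 0 < ε := Real.exp_pos _
  have hε1 : ε ≤ 1 := Real.exp_le_one_iff.2 (by linarith)
  have hεp : ε * p ≤ s / 2 := by
    rw [hε, hL, Real.exp_neg, Real.exp_log (by positivity)]
    have : (2 * Real.exp 1 * p / s)⁻¹ * p = s / (2 * Real.exp 1) := by field_simp
    rw [this]
    gcongr
    linarith
  -- squared exponential moments of the correlations and of the projected noise
  set a : Fin p → Ω → ℝ := fun j ω =>
    Real.exp (3 / 8 * ((∑ i, X i j / Real.sqrt n * ξ ω i) / σ) ^ 2) with ha
  set e : Fin r → Ω → ℝ := fun k ω =>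
    Real.exp (3 / 8 * ((∑ i, v k i * ξ ω i) / σ) ^ 2) with he
  have hcol' : ∀ j, ∑ i, (X i j / Real.sqrt n) ^ 2 ≤ 1 := fun j => by
    simp_rw [div_pow, Real.sq_sqrt hn'.le]
    rw [← Finset.sum_div, div_le_one hn']
    exact hcol j
  have haI : ∀ j, Integrable (a j) P := fun j => (exp_sq_linearForm hσ hξ _ (hcol' j)).1
  have haE : ∀ j, ∫ ω, a j ω ∂P ≤ 2 := fun j => (exp_sq_linearForm hσ hξ _ (hcol' j)).2
  have heI : ∀ k, Integrable (e k) P := fun k => (exp_sq_linearForm hσ hξ _ (hv k)).1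
  have heE : ∀ k, ∫ ω, e k ω ∂P ≤ 2 := fun k => (exp_sq_linearForm hσ hξ _ (hv k)).2
  set b : Ω → ℝ := fun ω => 1 / s * ε ^ 6 * ∑ j, a j ω with hb
  have hb0 : ∀ ω, 0 ≤ b ω := fun ω =>
    mul_nonneg (by positivity) (Finset.sum_nonneg fun j _ => (Real.exp_pos _).le)
  have hbI : Integrable b P := (integrable_finsetSum _ fun j _ => haI j).const_mul _
  have hbE : ∫ ω, b ω ∂P ≤ 1 / s * ε ^ 6 * (2 * p) := by
    rw [hb, integral_const_mul, integral_finsetSum _ fun j _ => haI j]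
    gcongr
    calc ∑ j, ∫ ω, a j ω ∂P ≤ ∑ _j : Fin p, (2 : ℝ) := Finset.sum_le_sum fun j _ => haE j
      _ = 2 * p := by simp [mul_comm]
  set K : ℝ := p * (16 / 3) ^ 2 / (100 * s) ^ 2 with hK
  set Ψ : Ω → ℝ := fun ω => K * ∑ k, (b ω + ε ^ 2 * e k ω) with hΨ
  have hK0 : 0 ≤ K := by positivity
  have hΨ0 : ∀ ω, 0 ≤ Ψ ω := fun ω => mul_nonneg hK0 (Finset.sum_nonneg fun k _ =>
    add_nonneg (hb0 ω) (mul_nonneg (by positivity) (Real.exp_pos _).le))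
  have htI : ∀ k, Integrable (fun ω => b ω + ε ^ 2 * e k ω) P := fun k =>
    hbI.add ((heI k).const_mul _)
  have hΨI : Integrable Ψ P := (integrable_finsetSum _ fun k _ => htI k).const_mul _
  have hΨE : ∫ ω, Ψ ω ∂P ≤ 1 / 100 := by
    rw [hΨ, integral_const_mul, integral_finsetSum _ fun k _ => htI k]
    have h1 : ∀ k, ∫ ω, (b ω + ε ^ 2 * e k ω) ∂P ≤ 1 / s * ε ^ 6 * (2 * p) + ε ^ 2 * 2 := by
      intro k
      rw [integral_add hbI ((heI k).const_mul _), integral_const_mul (ε ^ 2) (e k)]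
      exact add_le_add hbE (mul_le_mul_of_nonneg_left (heE k) (by positivity))
    have hr' : (r : ℝ) ≤ p := by exact_mod_cast hr
    set ρ := ε * p / s with hρ
    have hρ0 : 0 ≤ ρ := by positivity
    have hρ1 : ρ ≤ 1 / 2 := by rw [hρ, div_le_iff₀ hs]; linarith
    calc K * ∑ k, ∫ ω, (b ω + ε ^ 2 * e k ω) ∂P
        ≤ K * ∑ _k : Fin r, (1 / s * ε ^ 6 * (2 * p) + ε ^ 2 * 2) := by
          gcongr with k; exact h1 k
      _ = K * (r * (1 / s * ε ^ 6 * (2 * p) + ε ^ 2 * 2)) := by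
          rw [Finset.sum_const, Finset.card_univ, Fintype.card_fin, nsmul_eq_mul]
      _ ≤ K * (p * (1 / s * ε ^ 6 * (2 * p) + ε ^ 2 * 2)) := by gcongr
      _ = 256 / 90000 * (2 * ρ ^ 3 * ε ^ 3 + 2 * ρ ^ 2) := by
          rw [hK, hρ]; field_simp; ring
      _ ≤ 256 / 90000 * (2 * (1 / 2) ^ 3 * 1 ^ 3 + 2 * (1 / 2) ^ 2) := by gcongr
      _ ≤ 1 / 100 := by norm_num
  have hY2 : ∀ ω, Real.sqrt (Ψ ω) ^ 2 = Ψ ω := fun ω => Real.sq_sqrt (hΨ0 ω)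
  have hYle : ∀ ω, Real.sqrt (Ψ ω) ≤ 1 / 20 + 5 * Ψ ω := fun ω => by
    nlinarith [hY2 ω, sq_nonneg (Real.sqrt (Ψ ω) - 1 / 10)]
  have hdomI : Integrable (fun ω => 1 / 20 + 5 * Ψ ω) P :=
    (integrable_const _).add (hΨI.const_mul _)
  have hYI : Integrable (fun ω => Real.sqrt (Ψ ω)) P :=
    hdomI.mono' (Real.continuous_sqrt.comp_aestronglyMeasurable hΨI.aestronglyMeasurable)
      (.of_forall fun ω => by
        rw [Real.norm_eq_abs, abs_of_nonneg (Real.sqrt_nonneg _)]; exact hYle ω)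
  refine ⟨fun ω => Real.sqrt (Ψ ω), fun ω => Real.sqrt_nonneg _, hYI, ?_, ?_, ?_, ?_⟩
  · simpa only [hY2] using hΨI
  · calc ∫ ω, Real.sqrt (Ψ ω) ∂P ≤ ∫ ω, (1 / 20 + 5 * Ψ ω) ∂P := integral_mono hYI hdomI hYle
      _ = 1 / 20 + 5 * ∫ ω, Ψ ω ∂P := by
        rw [integral_add (integrable_const _) (hΨI.const_mul _), integral_const_mul]; simp
      _ ≤ 1 / 10 := by linarith
  · simpa only [hY2] using hΨE
  intro ω
  by_cases hgood : ∀ T : Finset (Fin p), T.card = s →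
      ∑ j ∈ T, ((∑ i, X i j / Real.sqrt n * ξ ω i) / σ) ^ 2 ≤ 16 * L * s
  · exact Or.inl hgood
  right
  push Not at hgood
  obtain ⟨T, hT, hTg⟩ := hgood
  have hb1 : 1 ≤ b ω := one_le_exp_sum_of_large hs1 hT hTg
  have hx : ∀ k, (((∑ i, v k i * ξ ω i) / σ) ^ 2) ^ 2 ≤
      (16 / 3 * L) ^ 2 * (b ω + ε ^ 2 * e k ω) := fun k =>
    sq_le_exp_of_one_le hL1 hb1 (sq_nonneg _)
  have hsum : ∑ k, ((∑ i, v k i * ξ ω i) / σ) ^ 2 ≤ 100 * L * s * Real.sqrt (Ψ ω) := by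
    refine le_of_abs_le (abs_le_of_sq_le_sq ?_ (by positivity))
    calc (∑ k, ((∑ i, v k i * ξ ω i) / σ) ^ 2) ^ 2
        ≤ (Finset.univ : Finset (Fin r)).card * ∑ k, (((∑ i, v k i * ξ ω i) / σ) ^ 2) ^ 2 :=
          sq_sum_le_card_mul_sum_sq
      _ = r * ∑ k, (((∑ i, v k i * ξ ω i) / σ) ^ 2) ^ 2 := by simp
      _ ≤ p * ∑ k, (16 / 3 * L) ^ 2 * (b ω + ε ^ 2 * e k ω) := by
          gcongr with k
          exact hx k
      _ = (100 * L * s) ^ 2 * Ψ ω := by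
          rw [← Finset.mul_sum, hΨ, hK]; field_simp
      _ = (100 * L * s * Real.sqrt (Ψ ω)) ^ 2 := by rw [mul_pow _ (Real.sqrt _), hY2]
  intro u
  have hY0 := Real.sqrt_nonneg (Ψ ω)
  refine le_of_abs_le (abs_le_of_sq_le_sq ?_
    (by have := empNorm_nonneg (X *ᵥ u); positivity))
  have hXu : 0 ≤ ∑ i, (X *ᵥ u) i ^ 2 := Finset.sum_nonneg fun i _ => sq_nonneg _
  have hscale : ∑ k, (∑ i, v k i * ξ ω i) ^ 2 =
      σ ^ 2 * ∑ k, ((∑ i, v k i * ξ ω i) / σ) ^ 2 := by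
    rw [Finset.mul_sum]
    exact Finset.sum_congr rfl fun k _ => by field_simp
  calc (1 / (n : ℝ) * ∑ i, ξ ω i * (X *ᵥ u) i) ^ 2
      = (1 / (n : ℝ)) ^ 2 * (∑ i, ξ ω i * (X *ᵥ u) i) ^ 2 := by ring
    _ ≤ (1 / (n : ℝ)) ^ 2 * ((∑ k, (∑ i, v k i * ξ ω i) ^ 2) * ∑ i, (X *ᵥ u) i ^ 2) := by
        gcongr; exact hproj _ _
    _ ≤ (1 / (n : ℝ)) ^ 2 *
          ((σ ^ 2 * (100 * L * s * Real.sqrt (Ψ ω))) * ∑ i, (X *ᵥ u) i ^ 2) := by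
        rw [hscale]; gcongr
    _ = (100 * σ ^ 2 * L / n) * (s * Real.sqrt (Ψ ω) * empNorm (X *ᵥ u) ^ 2) := by
        rw [empNorm_sq]; field_simp
    _ ≤ lam ^ 2 * (s * Real.sqrt (Ψ ω) * empNorm (X *ᵥ u) ^ 2) := by gcongr
    _ = _ := by
        rw [mul_pow, mul_pow, mul_pow, Real.sq_sqrt hs.le, Real.sq_sqrt hY0]; ring

/-! ### Deterministic analysis of the Lasso -/

/-- The first-order optimality condition, obtained by moving from `b` towards `β`: convexity of the
penalty and strong convexity of the quadratic loss produce the extra term `‖X(b - β)‖_n²`. -/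
lemma IsLasso.basic_inequality {n p : ℕ} {X : Matrix (Fin n) (Fin p) ℝ} {f ξ : Fin n → ℝ}
    {lam : ℝ} (hlam : 0 ≤ lam) {b : Fin p → ℝ} (hb : IsLasso X (f + ξ) lam b) (β : Fin p → ℝ) :
    empNorm (X *ᵥ b - f) ^ 2 + empNorm (X *ᵥ (b - β)) ^ 2 ≤ empNorm (X *ᵥ β - f) ^ 2 +
      2 * (1 / (n : ℝ) * ∑ i, ξ i * (X *ᵥ (b - β)) i) +
        2 * lam * (∑ j, |β j| - ∑ j, |b j|) := by
  set w := X *ᵥ b with hw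
  set z := X *ᵥ (b - β) with hz
  have hβ : X *ᵥ β = w - z := by rw [hw, hz, Matrix.mulVec_sub]; abel
  have hexpand : ∀ (x y : Fin n → ℝ) (t : ℝ), empNorm (x - t • y) ^ 2 =
      empNorm x ^ 2 - 2 * t * (1 / n * ∑ i, x i * y i) + t ^ 2 * empNorm y ^ 2 := by
    intro x y t
    simp only [empNorm_sq, Pi.sub_apply, Pi.smul_apply, smul_eq_mul]
    have : ∑ i, (x i - t * y i) ^ 2 =
        ∑ i, x i ^ 2 - 2 * t * ∑ i, x i * y i + t ^ 2 * ∑ i, y i ^ 2 := by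
      rw [Finset.mul_sum, Finset.mul_sum, ← Finset.sum_sub_distrib, ← Finset.sum_add_distrib]
      exact Finset.sum_congr rfl fun i _ => by ring
    rw [this]; ring
  set c := 1 / (n : ℝ) * ∑ i, (w - (f + ξ)) i * z i with hc
  have hstep : ∀ t : ℝ, 0 < t → t ≤ 1 →
      2 * c ≤ t * empNorm z ^ 2 + 2 * lam * (∑ j, |β j| - ∑ j, |b j|) := by
    intro t ht0 ht1
    have h := hb (b - t • (b - β))
    have e1 : X *ᵥ (b - t • (b - β)) - (f + ξ) = (w - (f + ξ)) - t • z := by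
      rw [Matrix.mulVec_sub, Matrix.mulVec_smul]; abel
    have hpen : ∑ j, |(b - t • (b - β)) j| ≤ (1 - t) * ∑ j, |b j| + t * ∑ j, |β j| := by
      rw [Finset.mul_sum, Finset.mul_sum, ← Finset.sum_add_distrib]
      refine Finset.sum_le_sum fun j _ => ?_
      simp only [Pi.sub_apply, Pi.smul_apply, smul_eq_mul]
      calc |b j - t * (b j - β j)| = |(1 - t) * b j + t * β j| := by congr 1; ring
        _ ≤ |(1 - t) * b j| + |t * β j| := abs_add_le _ _
        _ = _ := by rw [abs_mul, abs_mul, abs_of_nonneg (by linarith : 0 ≤ 1 - t),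
          abs_of_pos ht0]
    rw [e1, hexpand, lqNorm_one, lqNorm_one] at h
    have h2 : 0 ≤ t * (t * empNorm z ^ 2 + 2 * lam * (∑ j, |β j| - ∑ j, |b j|) - 2 * c) := by
      have := mul_le_mul_of_nonneg_left hpen (by positivity : 0 ≤ 2 * lam)
      linarith
    have := nonneg_of_mul_nonneg_right h2 ht0
    linarith
  have hlim : 2 * c ≤ 2 * lam * (∑ j, |β j| - ∑ j, |b j|) := by
    refine le_of_forall_pos_le_add fun δ hδ => ?_
    have hz0 : 0 ≤ empNorm z ^ 2 := sq_nonneg _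
    set t := min 1 (δ / (empNorm z ^ 2 + 1)) with ht
    have ht0 : 0 < t := lt_min one_pos (by positivity)
    have h3 : t * (empNorm z ^ 2 + 1) ≤ δ := by
      rw [← le_div_iff₀ (by positivity)]; exact min_le_right _ _
    have := hstep t ht0 (min_le_left _ _)
    nlinarith
  have e2 := hexpand (w - f) z 1
  rw [one_smul, show w - f - z = X *ᵥ β - f by rw [hβ]; abel] at e2
  have e3 : c = 1 / (n : ℝ) * ∑ i, (w - f) i * z i - 1 / (n : ℝ) * ∑ i, ξ i * z i := by
    rw [hc, ← mul_sub, ← Finset.sum_sub_distrib]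
    congr 1
    exact Finset.sum_congr rfl fun i _ => by simp only [Pi.sub_apply, Pi.add_apply]; ring
  linarith

lemma sum_abs_sub_sum_abs_le {p : ℕ} (b β : Fin p → ℝ) :
    ∑ j, |β j| - ∑ j, |b j| ≤
      2 * ∑ j with β j ≠ 0, |(b - β) j| - ∑ j, |(b - β) j| := by
  rw [Finset.sum_filter, Finset.mul_sum, ← Finset.sum_sub_distrib, ← Finset.sum_sub_distrib]
  refine Finset.sum_le_sum fun j _ => ?_
  by_cases h : β j = 0
  · simp [h]
  · simp only [ne_eq, h, not_false_eq_true, if_true, Pi.sub_apply]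
    have := abs_sub_abs_le_abs_sub (β j) (b j)
    rw [abs_sub_comm] at this
    linarith

/-- The risk bound as a statement on real numbers. With `u = b - β`, the variables stand for
`N = √s |u|₂`, `A` the sum of `|u_j|` off the `s` largest coordinates, `U = |u|₁`, `x = ‖Xu‖_n`,
`F` and `D` the losses of `b` and `β`, and `M = λ √s / θ`. The noise is either absorbed by the
penalty, or at most `r x`. If the coefficient of the penalty is negative there is nothing to prove;
otherwise `u` is in the cone and the quadratic term `x²` is used. -/
lemma excess_risk_le {lam N A U x F D M r ν : ℝ} (hlam : 0 < lam) (hA : 0 ≤ A)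
    (h : lam / 2 * U + F + x ^ 2 ≤ D + 2 * ν + 2 * lam * (5 / 4 * N - 3 / 4 * A))
    (hcone : A ≤ 7 * N → lam * N ≤ M * x)
    (hν : ν ≤ 3 / 8 * lam * (N + A) ∨ ν ≤ r * x) :
    lam / 2 * U + F ≤ D + 169 / 64 * M ^ 2 + 5 / 2 * r ^ 2 := by
  have hlA : 0 ≤ lam * A := by positivity
  rcases hν with hν | hν
  · rcases le_or_gt (3 * A) (13 * N) with hc | hc
    · have := hcone (by linarith)
      nlinarith [sq_nonneg (x - 13 / 8 * M), sq_nonneg r]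
    · have : lam * (13 * N) ≤ lam * (3 * A) := by gcongr
      nlinarith [sq_nonneg M, sq_nonneg r, sq_nonneg x]
  · rcases le_or_gt (3 * A) (5 * N) with hc | hc
    · have := hcone (by linarith)
      nlinarith [sq_nonneg (x - r - 5 / 4 * M), sq_nonneg (3 / 2 * r - 5 / 4 * M), sq_nonneg r,
        sq_nonneg M, sq_nonneg (r - M)]
    · have : lam * (5 * N) ≤ lam * (3 * A) := by gcongr
      nlinarith [sq_nonneg M, sq_nonneg r, sq_nonneg (x - r)]

/-- The estimation bounds, in the notation of `excess_risk_le`, for an exact model: there the loss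
of `b` is `x²` itself and the loss of `β` vanishes. -/
lemma estimation_error_le {lam N A U x M r ν : ℝ} (hlam : 0 < lam) (hx : 0 ≤ x) (hA : 0 ≤ A)
    (hM : 0 ≤ M) (hr : 0 ≤ r) (hN : 0 ≤ N) (hAU : A ≤ U)
    (h : lam / 2 * U + x ^ 2 + x ^ 2 ≤ 2 * ν + 2 * lam * (5 / 4 * N - 3 / 4 * A))
    (hcone : A ≤ 7 * N → lam * N ≤ M * x)
    (hν : ν ≤ 3 / 8 * lam * (N + A) ∨ ν ≤ r * x) :
    lam * U ≤ 169 / 64 * M ^ 2 + 5 / 2 * r ^ 2 ∧ lam * N ≤ 169 / 64 * M ^ 2 + 5 / 2 * r ^ 2 := by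
  have hlA : 0 ≤ lam * A := by positivity
  have hlU : lam * A ≤ lam * U := by gcongr
  have hlN : 0 ≤ lam * N := by positivity
  -- a quadratic inequality `2x² ≤ 2Bx` bounds `x`
  have hquad : ∀ B : ℝ, 0 ≤ B → 2 * x ^ 2 ≤ 2 * B * x → x ≤ B := fun B hB hq => by
    rcases eq_or_lt_of_le hx with h0 | h0
    · linarith
    · nlinarith
  rcases hν with hν | hν
  · rcases le_or_gt (3 * A) (13 * N) with hc | hc
    · have hc' := hcone (by linarith)
      refine ⟨by nlinarith [sq_nonneg (x - 13 / 16 * M), sq_nonneg r], ?_⟩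
      have hxB : x ≤ 13 / 8 * M := hquad _ (by positivity) (by nlinarith)
      have := mul_le_mul_of_nonneg_left hxB hM
      nlinarith [sq_nonneg M, sq_nonneg r]
    · have h1 : lam * (13 * N) ≤ lam * (3 * A) := by gcongr
      constructor <;> nlinarith [sq_nonneg M, sq_nonneg r, sq_nonneg x]
  · rcases le_or_gt A (7 * N) with hc | hc
    · have hc' := hcone hc
      refine ⟨by nlinarith [sq_nonneg (x - (r + 5 / 4 * M) / 2), sq_nonneg (r - M),
        sq_nonneg r, sq_nonneg M], ?_⟩
      have hxB : x ≤ r + 5 / 4 * M := hquad _ (by positivity) (by nlinarith)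
      have := mul_le_mul_of_nonneg_left hxB hM
      nlinarith [sq_nonneg (M - r), sq_nonneg M, sq_nonneg r]
    · have h1 : lam * (7 * N) ≤ lam * A := by gcongr
      have : lam * U ≤ 169 / 64 * M ^ 2 + 5 / 2 * r ^ 2 := by
        nlinarith [sq_nonneg M, sq_nonneg r, sq_nonneg (x - r / 2)]
      exact ⟨this, by linarith⟩

/-- Both regimes of the noise lead to the same pair of pointwise bounds, with `Y` measuring the
excess over the bulk event. -/
lemma IsLasso.pointwise_bounds {n p s : ℕ} (hn : 0 < n) (hs1 : 1 ≤ s) (hsp : s ≤ p) {σ : ℝ}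
    (hσ : 0 < σ) {X : Matrix (Fin n) (Fin p) ℝ} (hθ : 0 < theta X s 7) {lam L : ℝ}
    (hlam0 : 0 < lam) (hL : 0 ≤ L)
    (hlam : 32 / 3 * σ * Real.sqrt (L / n) ≤ lam) {f ξ : Fin n → ℝ} {Y : ℝ} (hY : 0 ≤ Y)
    (hnoise : (∀ T : Finset (Fin p), T.card = s →
          ∑ j ∈ T, ((∑ i, X i j / Real.sqrt n * ξ i) / σ) ^ 2 ≤ 16 * L * s) ∨
        ∀ u : Fin p → ℝ, 1 / (n : ℝ) * ∑ i, ξ i * (X *ᵥ u) i ≤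
          lam * Real.sqrt s * Real.sqrt Y * empNorm (X *ᵥ u))
    {b : Fin p → ℝ} (hb : IsLasso X (f + ξ) lam b) {β : Fin p → ℝ} (hβ : l0Norm β ≤ s) :
    lam / 2 * lqNorm 1 (b - β) + empNorm (X *ᵥ b - f) ^ 2 ≤ empNorm (X *ᵥ β - f) ^ 2 +
        lam ^ 2 * s * (169 / 64 / theta X s 7 ^ 2 + 5 / 2 * Y) ∧
      (f = X *ᵥ β →
        ∑ j, |(b - β) j| ≤ lam * s * (169 / 64 / theta X s 7 ^ 2 + 5 / 2 * Y) ∧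
        ∑ j, |(b - β) j| ^ 2 ≤ lam ^ 2 * s * (169 / 64 / theta X s 7 ^ 2 + 5 / 2 * Y) ^ 2) := by
  set θ := theta X s 7 with hθdef
  set u := b - β with hu
  have hs : (0 : ℝ) < s := by exact_mod_cast hs1
  have hn' : (0 : ℝ) < n := by exact_mod_cast hn
  obtain ⟨S, hS, htop, hpair⟩ := exists_top_set hs1 hsp u
  set l2 := Real.sqrt (∑ j, u j ^ 2) with hl2
  have hl2' : l2 ^ 2 = ∑ j, u j ^ 2 := Real.sq_sqrt (Finset.sum_nonneg fun i _ => sq_nonneg _)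
  set N := Real.sqrt s * l2 with hN
  set A := ∑ j ∈ Sᶜ, |u j| with hA
  set x := empNorm (X *ᵥ u) with hx
  set M := lam * Real.sqrt s / θ with hM
  set r := lam * Real.sqrt s * Real.sqrt Y with hr
  have hN0 : 0 ≤ N := by positivity
  have hA0 : 0 ≤ A := Finset.sum_nonneg fun _ _ => abs_nonneg _
  have hx0 : 0 ≤ x := empNorm_nonneg _
  have hsum : ∑ j ∈ S, |u j| + A = ∑ j, |u j| := Finset.sum_add_sum_compl S _
  have hSN : ∑ j ∈ S, |u j| ≤ N := by
    rw [hN, ← Real.sqrt_mul hs.le]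
    apply Real.le_sqrt_of_sq_le
    have h1 := sq_sum_le_card_mul_sum_sq (s := S) (f := fun j => |u j|)
    rw [hS] at h1
    have h2 : ∑ j ∈ S, |u j| ^ 2 ≤ ∑ j, u j ^ 2 := by
      simp only [sq_abs]
      exact Finset.sum_le_sum_of_subset_of_nonneg (Finset.subset_univ _) fun _ _ _ => sq_nonneg _
    exact h1.trans (by gcongr)
  have hcone : A ≤ 7 * N → lam * N ≤ M * x := by
    intro hAN
    have h1 : θ * l2 ≤ x := by
      have := theta_mul_le (s := s) (c₀ := 7) X (δ := u) (by
        rw [coneSRE, Set.mem_ofPred_eq, lqNorm_one, lqNorm_two, ← hsum, ← hl2, mul_assoc, ← hN]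
        linarith)
      rwa [lqNorm_two] at this
    calc lam * N = lam * Real.sqrt s / θ * (θ * l2) := by rw [hN]; field_simp
      _ ≤ _ := by gcongr
  set ν := 1 / (n : ℝ) * ∑ i, ξ i * (X *ᵥ u) i with hν
  have hnu : ν ≤ 3 / 8 * lam * (N + A) ∨ ν ≤ r * x := by
    rcases hnoise with hgood | hbad
    · left
      set g : Fin p → ℝ := fun j => (∑ i, X i j / Real.sqrt n * ξ i) / σ with hg
      have h1 : ν = σ / Real.sqrt n * ∑ j, u j * g j := by
        have h2 : ∀ i, (X *ᵥ u) i = ∑ j, X i j * u j := fun i => rfl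
        simp_rw [hν, h2, hg, Finset.sum_div, Finset.mul_sum]
        rw [Finset.sum_comm]
        refine Finset.sum_congr rfl fun j _ => Finset.sum_congr rfl fun i _ => ?_
        have : (n : ℝ) = Real.sqrt n * Real.sqrt n := (Real.mul_self_sqrt hn'.le).symm
        have h3 : Real.sqrt n ≠ 0 := by positivity
        rw [show 1 / (n : ℝ) = 1 / (Real.sqrt n * Real.sqrt n) by rw [← this]]
        field_simp
      have h2 := hpair g (4 * Real.sqrt L) (by positivity) (fun T hT => by
        rw [mul_pow, Real.sq_sqrt hL]; norm_num; exact hgood T hT)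
      rw [h1]
      calc σ / Real.sqrt n * ∑ j, u j * g j
          ≤ σ / Real.sqrt n * (4 * Real.sqrt L * (N + A)) := by gcongr
        _ = 3 / 8 * (32 / 3 * σ * Real.sqrt (L / n)) * (N + A) := by
          rw [Real.sqrt_div hL]; ring
        _ ≤ _ := by gcongr
    · exact Or.inr (hbad u)
  have hbasic := hb.basic_inequality hlam0.le β
  have hJ := htop (Finset.univ.filter fun j => β j ≠ 0) hβ
  have hdiff := sum_abs_sub_sum_abs_le b β
  rw [← hu] at hbasic hdiff
  have hpen : lam / 2 * ∑ j, |u j| + 2 * lam * (∑ j, |β j| - ∑ j, |b j|) ≤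
      2 * lam * (5 / 4 * N - 3 / 4 * A) := by
    have : 1 / 4 * ∑ j, |u j| + (∑ j, |β j| - ∑ j, |b j|) ≤ 5 / 4 * N - 3 / 4 * A := by linarith
    have := mul_le_mul_of_nonneg_left this (by positivity : 0 ≤ 2 * lam)
    linarith
  have hM2 : M ^ 2 = lam ^ 2 * s / θ ^ 2 := by rw [hM, div_pow, mul_pow, Real.sq_sqrt hs.le]
  have hr2 : r ^ 2 = lam ^ 2 * s * Y := by
    rw [hr, mul_pow, mul_pow, Real.sq_sqrt hs.le, Real.sq_sqrt hY]
  have hW : 169 / 64 * M ^ 2 + 5 / 2 * r ^ 2 =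
      lam ^ 2 * s * (169 / 64 / θ ^ 2 + 5 / 2 * Y) := by rw [hM2, hr2]; ring
  refine ⟨?_, fun hf => ?_⟩
  · rw [lqNorm_one, ← hW, ← add_assoc]
    refine excess_risk_le hlam0 hA0 (x := x) ?_ hcone hnu
    linarith
  · have e1 : empNorm (X *ᵥ b - f) = x := by rw [hf, hx, hu, Matrix.mulVec_sub]
    have e2 : empNorm (X *ᵥ β - f) = 0 := by rw [hf]; simp [empNorm]
    rw [e1, e2] at hbasic
    have hAU : A ≤ ∑ j, |u j| := by
      rw [← hsum]; linarith [Finset.sum_nonneg fun j (_ : j ∈ S) => abs_nonneg (u j)]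
    obtain ⟨h1, h2⟩ := estimation_error_le hlam0 hx0 hA0 (by positivity : 0 ≤ M)
      (by positivity : 0 ≤ r) hN0 hAU (by linarith) hcone hnu
    rw [hW] at h1 h2
    set W := 169 / 64 / θ ^ 2 + 5 / 2 * Y with hWdef
    have h1' : lam * ∑ j, |u j| ≤ lam * (lam * s * W) := by linarith
    have h2' : lam * N ≤ lam * (lam * s * W) := by linarith
    refine ⟨le_of_mul_le_mul_left h1' hlam0, ?_⟩
    have h3 : N ^ 2 ≤ (lam * s * W) ^ 2 :=
      pow_le_pow_left₀ hN0 (le_of_mul_le_mul_left h2' hlam0) 2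
    rw [hN, mul_pow, Real.sq_sqrt hs.le, hl2'] at h3
    simp only [sq_abs]
    have h4 : s * ∑ j, u j ^ 2 ≤ s * (lam ^ 2 * s * W ^ 2) := by linarith
    exact le_of_mul_le_mul_left h4 hs

end SparseReg

/-! ### Integration -/

open SparseReg in
theorem mainTheorem5 {Ω : Type*} [MeasurableSpace Ω] (P : Measure Ω) [IsProbabilityMeasure P]
    (n p s : ℕ) (hs1 : 1 ≤ s) (hsp : s ≤ p)
    (σ : ℝ) (hσ : 0 < σ)
    (X : Matrix (Fin n) (Fin p) ℝ) (hX : SparseReg.SRE X s 7)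
    (lam : ℝ)
    (hlam : (4 + Real.sqrt 2) * σ / (1 / 2) *
      Real.sqrt (Real.log (2 * Real.exp 1 * (p : ℝ) / (s : ℝ)) / (n : ℝ)) ≤ lam)
    (f : Fin n → ℝ) (ξ : Ω → Fin n → ℝ)
    (hξ : HasLaw ξ (SparseReg.isotropicGaussian n σ) P)
    (βhat : Ω → Fin p → ℝ) (hβmeas : AEMeasurable βhat P)
    (hβhat : ∀ᵐ ω ∂P, SparseReg.IsLasso X (f + ξ ω) lam (βhat ω)) :
    (∀ β : Fin p → ℝ, SparseReg.l0Norm β ≤ s →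
      Integrable (fun ω => lam / 2 * SparseReg.lqNorm 1 (βhat ω - β) +
        SparseReg.empNorm (X *ᵥ βhat ω - f) ^ 2) P ∧
      ∫ ω, (lam / 2 * SparseReg.lqNorm 1 (βhat ω - β) +
          SparseReg.empNorm (X *ᵥ βhat ω - f) ^ 2) ∂P ≤
        SparseReg.empNorm (X *ᵥ β - f) ^ 2 +
          49 * lam ^ 2 * (s : ℝ) / 16 *
            (1 / SparseReg.theta X s 7 ^ 2 +
              1 / (2 * Real.log (2 * Real.exp 1 * (p : ℝ))))) ∧
    (∀ βstar : Fin p → ℝ, SparseReg.l0Norm βstar ≤ s → f = X *ᵥ βstar →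
      ∀ q : ℝ, 1 ≤ q → q ≤ 2 →
        Integrable (fun ω => SparseReg.lqNorm q (βstar - βhat ω) ^ q) P ∧
        ∫ ω, SparseReg.lqNorm q (βstar - βhat ω) ^ q ∂P ≤
          (49 : ℝ) ^ q * lam ^ q * (s : ℝ) / (8 : ℝ) ^ q *
            (1 / SparseReg.theta X s 7 ^ (2 * q) +
              1 / Real.log (2 * Real.exp 1 * (p : ℝ)) ^ q)) := by
  obtain ⟨hcolX, hθ⟩ := hX
  have hp1 : 1 ≤ p := hs1.trans hsp
  have hs : (0 : ℝ) < s := by exact_mod_cast hs1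
  have hsp' : (s : ℝ) ≤ p := by exact_mod_cast hsp
  have hp : (1 : ℝ) ≤ p := by exact_mod_cast hp1
  have he1 : (1 : ℝ) ≤ Real.exp 1 := Real.one_le_exp (by norm_num)
  have hθ_single := theta_le_empNorm_single hs1 X ⟨0, hp1⟩
  have hθ1 : theta X s 7 ≤ 1 := hθ_single.trans (hcolX _)
  have hn : 0 < n := by
    rcases Nat.eq_zero_or_pos n with rfl | h
    · simp [empNorm] at hθ_single
      linarith
    · exact h
  have hn' : (0 : ℝ) < n := by exact_mod_cast hn
  have hlog : 0 < Real.log (2 * Real.exp 1 * (p : ℝ)) := Real.log_pos (by nlinarith)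
  set L := Real.log (2 * Real.exp 1 * (p : ℝ) / (s : ℝ)) with hL
  have hL0 : 0 < L := Real.log_pos (by rw [one_lt_div hs]; nlinarith)
  have hsq0 : 0 < Real.sqrt (L / n) := by positivity
  have hsqrt2 : 4 / 3 ≤ Real.sqrt 2 := Real.le_sqrt_of_sq_le (by norm_num)
  have hlam' : 32 / 3 * σ * Real.sqrt (L / n) ≤ lam := by
    refine le_trans ?_ hlam
    gcongr
    nlinarith
  have hlam0 : 0 < lam := lt_of_lt_of_le (by positivity) hlam'
  have hlamsq : 100 * σ ^ 2 * L / n ≤ lam ^ 2 := by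
    calc 100 * σ ^ 2 * L / n ≤ (32 / 3) ^ 2 * σ ^ 2 * (L / n) := by
          rw [mul_div_assoc]; gcongr; norm_num
      _ = (32 / 3 * σ * Real.sqrt (L / n)) ^ 2 := by
          rw [mul_pow, mul_pow, Real.sq_sqrt (by positivity)]
      _ ≤ _ := by gcongr
  have hcol : ∀ j, ∑ i, X i j ^ 2 ≤ n := fun j => by
    have h := pow_le_one₀ (empNorm_nonneg _) (hcolX j) (n := 2)
    rw [empNorm_sq, one_div, ← div_eq_inv_mul, div_le_one hn'] at h
    simpa using h
  obtain ⟨Y, hY0, hYI, hY2I, hYE, hY2E, hYn⟩ :=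
    exists_noise_majorant hn hs1 hsp hσ X hcol hlam0 hL hlamsq hξ
  set θ := theta X s 7 with hθdef
  have hθinv : 1 ≤ 1 / θ ^ 2 := by
    rw [one_le_div (by positivity)]; exact pow_le_one₀ hθ.le hθ1
  constructor
  · intro β hβ
    have hbound : ∀ᵐ ω ∂P, lam / 2 * lqNorm 1 (βhat ω - β) + empNorm (X *ᵥ βhat ω - f) ^ 2 ≤
        empNorm (X *ᵥ β - f) ^ 2 + lam ^ 2 * s * (169 / 64 / θ ^ 2 + 5 / 2 * Y ω) := by
      filter_upwards [hβhat] with ω hω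
      exact (hω.pointwise_bounds hn hs1 hsp hσ hθ hlam0 hL0.le hlam' (hY0 ω) (hYn ω) hβ).1
    have hinner : Integrable (fun ω => 169 / 64 / θ ^ 2 + 5 / 2 * Y ω) P :=
      (integrable_const _).add (hYI.const_mul _)
    have hdomI : Integrable (fun ω => empNorm (X *ᵥ β - f) ^ 2 +
        lam ^ 2 * s * (169 / 64 / θ ^ 2 + 5 / 2 * Y ω)) P :=
      (integrable_const _).add (hinner.const_mul _)
    have hmeas : Measurable fun b : Fin p → ℝ =>
        lam / 2 * lqNorm 1 (b - β) + empNorm (X *ᵥ b - f) ^ 2 := by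
      simp only [lqNorm, empNorm, Matrix.mulVec, dotProduct, Pi.sub_apply]
      fun_prop
    have hI : Integrable (fun ω => lam / 2 * lqNorm 1 (βhat ω - β) +
        empNorm (X *ᵥ βhat ω - f) ^ 2) P :=
      hdomI.mono' (hmeas.comp_aemeasurable hβmeas).aestronglyMeasurable (by
        filter_upwards [hbound] with ω hω
        have := lqNorm_nonneg 1 (βhat ω - β)
        rwa [Real.norm_eq_abs, abs_of_nonneg (by positivity)])
    refine ⟨hI, (integral_mono_ae hI hdomI hbound).trans ?_⟩
    rw [integral_add (integrable_const _) (hinner.const_mul _), integral_const_mul,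
      integral_add (integrable_const _) (hYI.const_mul _), integral_const_mul]
    simp only [integral_const, probReal_univ, smul_eq_mul, one_mul]
    have hlog' : 0 ≤ 1 / (2 * Real.log (2 * Real.exp 1 * (p : ℝ))) := by positivity
    -- the gap between `169/64` and `49/16` pays for `E Y`, since `θ ≤ 1`
    have : 169 / 64 / θ ^ 2 + 5 / 2 * ∫ ω, Y ω ∂P ≤
        49 / 16 * (1 / θ ^ 2 + 1 / (2 * Real.log (2 * Real.exp 1 * (p : ℝ)))) := by
      have : 169 / 64 / θ ^ 2 = 169 / 64 * (1 / θ ^ 2) := by ring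
      linarith
    have := mul_le_mul_of_nonneg_left this (by positivity : 0 ≤ lam ^ 2 * s)
    linarith
  · intro β hβ hf q hq1 hq2
    set w : Ω → ℝ := fun ω => 8 / 49 * (169 / 64 + 5 / 2 * Y ω) with hw
    have hw0 : ∀ ω, 0 ≤ w ω := fun ω => by have := hY0 ω; positivity
    set C : ℝ := (49 : ℝ) ^ q * lam ^ q * s / (8 : ℝ) ^ q * (1 / θ ^ (2 * q)) with hC
    have hC0 : 0 ≤ C := by positivity
    have hbound : ∀ᵐ ω ∂P, lqNorm q (β - βhat ω) ^ q ≤ C * (w ω + w ω ^ 2) := by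
      filter_upwards [hβhat] with ω hω
      obtain ⟨h1, h2⟩ :=
        (hω.pointwise_bounds hn hs1 hsp hσ hθ hlam0 hL0.le hlam' (hY0 ω) (hYn ω) hβ).2 hf
      have h := sum_rpow_le_interpolation Finset.univ (fun j => |(βhat ω - β) j|)
        (fun _ => abs_nonneg _) hq1 hq2 h1 h2
      have hWle : 169 / 64 / θ ^ 2 + 5 / 2 * Y ω ≤ 49 / 8 * w ω / θ ^ 2 := by
        have : 49 / 8 * w ω / θ ^ 2 = 169 / 64 / θ ^ 2 + 5 / 2 * Y ω * (1 / θ ^ 2) := by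
          rw [hw]; ring
        rw [this]
        have := le_mul_of_one_le_right (by have := hY0 ω; positivity : 0 ≤ 5 / 2 * Y ω) hθinv
        linarith
      set W := 169 / 64 / θ ^ 2 + 5 / 2 * Y ω with hW
      have hW0 : 0 ≤ W := by have := hY0 ω; positivity
      have hpow : (lam * s * W) ^ (2 - q) * (lam ^ 2 * s * W ^ 2) ^ (q - 1) =
          lam ^ q * s * W ^ q := by
        have e : ∀ a : ℝ, 0 ≤ a → a ^ (2 - q) * (a ^ 2) ^ (q - 1) = a ^ q := fun a ha => by
          rw [← Real.rpow_natCast, ← Real.rpow_mul ha, ← Real.rpow_add_of_nonneg ha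
            (by linarith) (by push_cast; linarith)]
          congr 1; push_cast; ring
        have e' : (s : ℝ) ^ (2 - q) * (s : ℝ) ^ (q - 1) = s := by
          rw [← Real.rpow_add hs]; norm_num
        rw [Real.mul_rpow (by positivity) hW0, Real.mul_rpow hlam0.le hs.le,
          Real.mul_rpow (by positivity) (by positivity), Real.mul_rpow (by positivity) hs.le]
        calc _ = (lam ^ (2 - q) * (lam ^ 2) ^ (q - 1)) * ((s : ℝ) ^ (2 - q) * (s : ℝ) ^ (q - 1)) *
              (W ^ (2 - q) * (W ^ 2) ^ (q - 1)) := by ring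
          _ = _ := by rw [e _ hlam0.le, e _ hW0, e']
      have hwq : w ω ^ q ≤ w ω + w ω ^ 2 := by
        rcases le_total (w ω) 1 with h1 | h1
        · have := Real.rpow_le_rpow_of_exponent_ge' (hw0 ω) h1 zero_le_one hq1
          rw [Real.rpow_one] at this
          nlinarith [sq_nonneg (w ω)]
        · have := Real.rpow_le_rpow_of_exponent_le h1 hq2
          rw [Real.rpow_two] at this
          linarith [hw0 ω]
      rw [lqNorm_rpow hq1]
      calc ∑ j, |(β - βhat ω) j| ^ q = ∑ j, |(βhat ω - β) j| ^ q :=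
            Finset.sum_congr rfl fun j _ => by rw [Pi.sub_apply, Pi.sub_apply, abs_sub_comm]
        _ ≤ lam ^ q * s * W ^ q := h.trans_eq hpow
        _ ≤ lam ^ q * s * (49 / 8 * w ω / θ ^ 2) ^ q := by
          have := Real.rpow_le_rpow hW0 hWle (by linarith : 0 ≤ q)
          gcongr
        _ = C * w ω ^ q := by
          rw [Real.div_rpow (mul_nonneg (by norm_num) (hw0 ω)) (by positivity),
            Real.mul_rpow (by norm_num) (hw0 ω), Real.div_rpow (by norm_num) (by norm_num), hC,
            Real.rpow_mul hθ.le, Real.rpow_two]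
          ring
        _ ≤ C * (w ω + w ω ^ 2) := by gcongr
    have hdom : ∀ ω, w ω + w ω ^ 2 = (8 / 49 * (169 / 64) + (8 / 49 * (169 / 64)) ^ 2) +
        ((8 / 49 * (5 / 2) + 2 * (8 / 49) ^ 2 * (169 / 64) * (5 / 2)) * Y ω +
          (8 / 49 * (5 / 2)) ^ 2 * Y ω ^ 2) := fun ω => by rw [hw]; ring
    have hI2 : Integrable (fun ω => (8 / 49 * (5 / 2) + 2 * (8 / 49) ^ 2 * (169 / 64) * (5 / 2)) *
        Y ω + (8 / 49 * (5 / 2)) ^ 2 * Y ω ^ 2) P := (hYI.const_mul _).add (hY2I.const_mul _)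
    have hdomI : Integrable (fun ω => C * (w ω + w ω ^ 2)) P := by
      simp only [hdom]
      exact ((integrable_const _).add hI2).const_mul _
    have hdomE : ∫ ω, (w ω + w ω ^ 2) ∂P ≤ 1 := by
      simp only [hdom]
      rw [integral_add (integrable_const _) hI2,
        integral_add (hYI.const_mul _) (hY2I.const_mul _), integral_const_mul, integral_const_mul]
      simp only [integral_const, probReal_univ, smul_eq_mul, one_mul]
      linarith
    have hmeas : Measurable fun b : Fin p → ℝ => lqNorm q (β - b) ^ q := by
      simp only [lqNorm, Pi.sub_apply]
      fun_prop
    have hI : Integrable (fun ω => lqNorm q (β - βhat ω) ^ q) P :=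
      hdomI.mono' (hmeas.comp_aemeasurable hβmeas).aestronglyMeasurable (by
        filter_upwards [hbound] with ω hω
        rwa [Real.norm_eq_abs, abs_of_nonneg (Real.rpow_nonneg (lqNorm_nonneg _ _) _)])
    refine ⟨hI, ?_⟩
    calc _ ≤ ∫ ω, C * (w ω + w ω ^ 2) ∂P := integral_mono_ae hI hdomI hbound
      _ = C * ∫ ω, (w ω + w ω ^ 2) ∂P := integral_const_mul _ _
      _ ≤ C * 1 := by gcongr
      _ ≤ _ := by
        rw [mul_one, hC]
        gcongr
        exact le_add_of_nonneg_right (by positivity)
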